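/- Let $r,a_+,a_->0$. For $\alpha>0$ and $z\in\mathbb C$ put $$R(r,\alpha;z)=\prod_{k=1}^{\infty}\bigl[1-e^{2irz-(2k-1)\alpha r}\bigr]\bigl[1-e^{-2irz-(2k-1)\alpha r}\bigr],\qquad R_\delta(z)=R(r,a_\delta;z)\quad(\delta=+,-),$$ and let $$G(z)=\prod_{m,n=0}^{\infty}\frac{1-\exp\bigl(-(2m+1)ra_+-(2n+1)ra_--2irz\bigr)}{1-\exp\bigl(-(2m+1)ra_+-(2n+1)ra_-+2irz\bigr)}$$ be the elliptic gamma function. For $v,w,z\in\mathbb C^3$ define $$\mathcal S_2(v,w,z)=\prod_{k,l,m=1}^{3}G(v_k+w_l+z_m-\delta_2),\qquad \delta_2=\tfrac{i}{6}(a_++a_-).$$ For $\delta\in\{+,-\}$ and $\mu\in\mathbb C$ let $A_{2,\delta}(\mu;x)$ be the analytic difference operator $$(A_{2,\delta}(\mu;x)f)(x)=\sum_{j=1}^{3}\frac{R_\delta(x_{j+1}-x_{j+2}+\mu)\,R_\delta(x_{j+1}-x_{j+2}-\mu)}{R_\delta(x_j-x_{j+1}-ia_\delta/2)\,R_\delta(x_j-x_{j+2}-ia_\delta/2)}\;f\bigl(x+\tfrac{i}{3}a_{-\delta}(3e_j-e_1-e_2-e_3)\bigr),$$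 where indices are read modulo $3$ and $e_1,e_2,e_3$ is the standard basis of $\mathbb C^3$. Then for all $\mu\in\mathbb C$ and $\delta=+,-$, on the set of $v,w,z\in\mathbb C^3$ with $\sum_{j}v_j=\sum_{j}w_j=\sum_{j}z_j=0$, one has $$A_{2,\delta}(\mu;v)\,\mathcal S_2(v,w,z)=A_{2,\delta}(\mu;w)\,\mathcal S_2(v,w,z)=A_{2,\delta}(\mu;z)\,\mathcal S_2(v,w,z)$$ as an equality of meromorphic functions; that is, any two of these three expressions take the same value at every such $(v,w,z)$ at which, in both of them, no denominator $R_\delta$ of a coefficient vanishes and no factor $G$ of a shifted $\mathcal S_2$ has a pole. -/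

import Mathlib

noncomputable section

namespace Razamat

open Complex

/-- The elliptic building block `R(r, α; z)`, the product of
`(1 - exp(2irz - (2k-1)αr)) (1 - exp(-2irz - (2k-1)αr))` over `k ≥ 1`
(here indexed by `k - 1 : ℕ`). -/
def R (r α : ℝ) (z : ℂ) : ℂ :=
  ∏' k : ℕ, (1 - exp (2 * I * r * z - (2 * k + 1) * α * r)) *
    (1 - exp (-2 * I * r * z - (2 * k + 1) * α * r))

/-- The elliptic gamma function `G(r, a₊, a₋; z)`. -/
def G (r ap am : ℝ) (z : ℂ) : ℂ :=
  ∏' p : ℕ × ℕ,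
    (1 - exp (-(2 * p.1 + 1) * r * ap - (2 * p.2 + 1) * r * am - 2 * I * r * z)) /
    (1 - exp (-(2 * p.1 + 1) * r * ap - (2 * p.2 + 1) * r * am + 2 * I * r * z))

/-- `z` is not a pole of the elliptic gamma function: no denominator factor vanishes
(numerator and denominator factors have no common zeros when `r, a₊, a₋ > 0`). -/
def GRegular (r ap am : ℝ) (z : ℂ) : Prop :=
  ∀ m n : ℕ,
    1 - exp (-(2 * m + 1) * r * ap - (2 * n + 1) * r * am + 2 * I * r * z) ≠ 0

/-- `a_δ`, where the sign `δ = +` is encoded as `true` and `δ = -` as `false`;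
the opposite sign `-δ` is then `!δ`. -/
def aSign (ap am : ℝ) (δ : Bool) : ℝ := if δ then ap else am

/-- `R_δ(z) = R(r, a_δ; z)`. -/
def RSign (r ap am : ℝ) (δ : Bool) (z : ℂ) : ℂ := R r (aSign ap am δ) z

/-- The argument of `G` in the kernel function: `v_k + w_l + z_m - i(a₊ + a₋)/6`. -/
def kernelArg (ap am : ℝ) (v w z : Fin 3 → ℂ) (k l m : Fin 3) : ℂ :=
  v k + w l + z m - I * (ap + am) / 6

/-- The kernel function `S₂(v, w, z)`. -/
def S2 (r ap am : ℝ) (v w z : Fin 3 → ℂ) : ℂ :=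
  ∏ k, ∏ l, ∏ m, G r ap am (kernelArg ap am v w z k l m)

/-- No factor of `S₂` has a pole at `(v, w, z)`. -/
def S2Regular (r ap am : ℝ) (v w z : Fin 3 → ℂ) : Prop :=
  ∀ k l m, GRegular r ap am (kernelArg ap am v w z k l m)

/-- The shift `exp((1/3) i b (2 ∂_{x_j} - ∂_{x_{j+1}} - ∂_{x_{j+2}}))` on points:
`2ib/3` is added to `x_j` and `-ib/3` to the other two coordinates. -/
def shift (b : ℝ) (j : Fin 3) (x : Fin 3 → ℂ) : Fin 3 → ℂ :=
  fun k => x k + I * b / 3 * (if k = j then 2 else -1)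

/-- The coefficient of the `j`-th summand of the difference operator `A_{2,δ}(μ; x)`; indices
are taken modulo 3, so the summands are cyclic permutations of each other. -/
def coeff (r ap am : ℝ) (δ : Bool) (μ : ℂ) (j : Fin 3) (x : Fin 3 → ℂ) : ℂ :=
  RSign r ap am δ (x (j + 1) - x (j + 2) + μ) * RSign r ap am δ (x (j + 1) - x (j + 2) - μ) /
    (RSign r ap am δ (x j - x (j + 1) - I * aSign ap am δ / 2) *
      RSign r ap am δ (x j - x (j + 2) - I * aSign ap am δ / 2))

/-- The analytic difference operator `A_{2,δ}(μ; x)`, applied to `f` and evaluated at `x`. -/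
def A2 (r ap am : ℝ) (δ : Bool) (μ : ℂ) (f : (Fin 3 → ℂ) → ℂ) (x : Fin 3 → ℂ) : ℂ :=
  ∑ j, coeff r ap am δ μ j x * f (shift (aSign ap am (!δ)) j x)

/-- Every summand of `A_{2,δ}(μ; x) f` is regular at `x`: the denominators of the coefficients
do not vanish, and the three shifted points are regular points of `f` (described by `reg`). -/
def A2Regular (r ap am : ℝ) (δ : Bool) (reg : (Fin 3 → ℂ) → Prop) (x : Fin 3 → ℂ) : Prop :=
  (∀ j k, j ≠ k → RSign r ap am δ (x j - x k - I * aSign ap am δ / 2) ≠ 0) ∧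
    ∀ j, reg (shift (aSign ap am (!δ)) j x)

end Razamat

end

/-!
Both `S₂` and the coefficients of `A_{2,δ}` can be written in terms of the odd theta function
`sigma`: by the difference equation of `G`, a shift of `v` multiplies `S₂` by a product of values
of `R_δ` and a factor symmetric in `v` and `w`. The theorem thus becomes the symmetry in `v` and
`w` of `kernelSum`, which we prove for any odd entire `s` whose brackets `s (x + y) * s (x - y)`
satisfy the Plücker relation. Fix `z 0` and vary the difference `2 * y` of the other two entries of
`z`. Both sides are then binary cubic forms in two brackets of `y`, so for generic `v`, `w` it
suffices to compare them at the nine points where some `v k + w l + z m` vanishes. There the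
identity reduces to `fourTerm`, which is linear in the bracket containing `ν` and vanishes at two
values of `ν`. Nongeneric arguments follow by continuity.

The Plücker relation for `sigma` holds because its brackets are, in the first variable, theta
functions of degree two with a common multiplier, and two Fourier coefficients determine such a
function: any three brackets are linearly dependent.
-/

noncomputable section

namespace Razamat

open Complex

section BinaryForms

variable {X K ι : Type*} [Field K] {n : ℕ}

/-- The functions on `X` that are binary forms of degree `n` in the two functions `g` and `h`. -/
def binaryForms (g h : X → K) (n : ℕ) : Submodule K (X → K) :=
  (MvPolynomial.homogeneousSubmodule (Fin 2) K n).map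
    (LinearMap.pi fun x => (MvPolynomial.aeval ![g x, h x]).toLinearMap)

variable {f g h : X → K}

theorem mem_binaryForms :
    f ∈ binaryForms g h n ↔
      ∃ F : MvPolynomial (Fin 2) K, F.IsHomogeneous n ∧ ∀ x, F.eval ![g x, h x] = f x := by
  refine Submodule.mem_map.trans (exists_congr fun F => and_congr Iff.rfl ?_)
  rw [funext_iff]
  exact forall_congr' fun x => by
    rw [LinearMap.pi_apply, AlgHom.toLinearMap_apply, MvPolynomial.aeval_eq_eval]

theorem mul_add_mul_mem_binaryForms_one (α β : K) :
    (fun x => α * g x + β * h x) ∈ binaryForms g h 1 := by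
  refine mem_binaryForms.mpr ⟨.C α * .X 0 + .C β * .X 1, ?_, fun x => ?_⟩
  · exact ((MvPolynomial.isHomogeneous_X K 0).C_mul α).add
      ((MvPolynomial.isHomogeneous_X K 1).C_mul β)
  · rw [map_add, map_mul, map_mul, MvPolynomial.eval_C, MvPolynomial.eval_C, MvPolynomial.eval_X,
      MvPolynomial.eval_X]
    rfl

theorem prod_mem_binaryForms_card [Fintype ι] {f : ι → X → K}
    (hf : ∀ i, f i ∈ binaryForms g h 1) :
    (fun x => ∏ i, f i x) ∈ binaryForms g h (Fintype.card ι) := by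
  choose F hF hFf using fun i => mem_binaryForms.mp (hf i)
  refine mem_binaryForms.mpr ⟨∏ i, F i, ?_, fun x => by simp only [map_prod, hFf]⟩
  simpa using MvPolynomial.IsHomogeneous.prod Finset.univ F (fun _ => 1) fun i _ => hF i

theorem eval_homogenize_of_snd_eq_zero (p : Polynomial K) {x : Fin 2 → K} (hx : x 1 = 0) :
    (p.homogenize n).eval x = p.coeff n * x 0 ^ n := by
  rw [Polynomial.homogenize, map_sum, Finset.sum_eq_single (n, 0)]
  · simp [MvPolynomial.eval_monomial, Finsupp.update_eq_add_single, Finsupp.prod_fintype]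
  · rintro ⟨i, j⟩ hij hne
    have hj : j ≠ 0 := by
      rintro rfl
      exact hne (by simpa using hij)
    simp [MvPolynomial.eval_monomial, Finsupp.update_eq_add_single, Finsupp.prod_fintype, hx, hj]
  · simp

theorem coeff_eq_zero_of_homogenize_eval_eq_zero [Fintype ι] {p : Polynomial K}
    (hn : n < Fintype.card ι) {x : ι → Fin 2 → K}
    (hx : Pairwise fun i j => x i 0 * x j 1 ≠ x i 1 * x j 0) {k : ι} (hk : x k 1 = 0)
    (h0 : (p.homogenize n).eval (x k) = 0) : p.coeff n = 0 := by
  rw [eval_homogenize_of_snd_eq_zero p hk] at h0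
  refine (mul_eq_zero.mp h0).resolve_right (mt (fun h => ?_) (not_lt.mpr hn.le))
  obtain ⟨hxk, hn0⟩ := pow_eq_zero_iff'.mp h
  obtain ⟨j, hj⟩ := Fintype.exists_ne_of_one_lt_card (by omega) k
  exact absurd (by rw [hk, hxk]; ring) (hx hj)

theorem eq_zero_of_homogenize_eval_eq_zero [Fintype ι] {p : Polynomial K}
    (hp : p.natDegree ≤ n) (hn : n < Fintype.card ι) {x : ι → Fin 2 → K}
    (hx : Pairwise fun i j => x i 0 * x j 1 ≠ x i 1 * x j 0)
    (h0 : ∀ i, (p.homogenize n).eval (x i) = 0) : p = 0 := by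
  classical
  let s : Finset ι := {i | x i 1 ≠ 0}
  have hs {i} : i ∈ s ↔ x i 1 ≠ 0 := by simp [s]
  have hinj : Set.InjOn (fun i => x i 0 / x i 1) s := fun i hi j hj hij => by
    by_contra hne
    exact hx hne (by rw [(div_eq_div_iff (hs.mp hi) (hs.mp hj)).mp hij, mul_comm])
  have hroot : ∀ i ∈ s, p.eval (x i 0 / x i 1) = 0 := fun i hi => by
    simpa [Polynomial.eval_homogenize hp _ (hs.mp hi), hs.mp hi] using h0 i
  refine Polynomial.eq_zero_of_degree_lt_of_eval_index_eq_zero _ hinj ?_ hroot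
  by_cases hinf : ∃ k, x k 1 = 0
  · obtain ⟨k, hk⟩ := hinf
    have hcard : n ≤ s.card := by
      have : s = Finset.univ.erase k := by
        ext i
        simp only [hs, Finset.mem_erase, Finset.mem_univ, and_true]
        exact ⟨fun hi hik => hi (hik ▸ hk), fun hik hi => hx hik (by rw [hi, hk]; ring)⟩
      rw [this, Finset.card_erase_of_mem (Finset.mem_univ k), Finset.card_univ]
      omega
    refine lt_of_lt_of_le ((Polynomial.degree_lt_iff_coeff_zero _ _).mpr fun m hm => ?_)
      (Nat.cast_le.mpr hcard)
    obtain rfl | hm := hm.eq_or_lt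
    · exact coeff_eq_zero_of_homogenize_eval_eq_zero hn hx hk (h0 k)
    · exact Polynomial.coeff_eq_zero_of_natDegree_lt (hp.trans_lt hm)
  · have : s = Finset.univ := Finset.filter_true_of_mem fun i _ hi => hinf ⟨i, hi⟩
    rw [this, Finset.card_univ]
    exact Polynomial.degree_le_natDegree.trans_lt (Nat.cast_lt.mpr (hp.trans_lt hn))

theorem eq_zero_of_mem_binaryForms [Fintype ι] (hf : f ∈ binaryForms g h n)
    (hn : n < Fintype.card ι) {Y : ι → X}
    (hY : Pairwise fun i j => g (Y i) * h (Y j) ≠ h (Y i) * g (Y j)) (h0 : ∀ i, f (Y i) = 0) :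
    f = 0 := by
  obtain ⟨F, hF, hFf⟩ := mem_binaryForms.mp hf
  have hp := Polynomial.homogenize_eq_of_isHomogeneous hF rfl
  have hdeg : (MvPolynomial.aeval ![Polynomial.X, 1] F : Polynomial K).natDegree ≤ n := by
    simpa using MvPolynomial.aeval_natDegree_le F hF.totalDegree_le _ (n := 1) fun i => by
      fin_cases i <;> simp
  have : MvPolynomial.aeval ![Polynomial.X, 1] F = 0 :=
    eq_zero_of_homogenize_eval_eq_zero (x := fun i => ![g (Y i), h (Y i)]) hdeg hn hY
      fun i => by rw [hp, hFf, h0]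
  rw [this, Polynomial.homogenize_zero] at hp
  funext x
  simpa [← hp] using (hFf x).symm

end BinaryForms

section SigmaLike

variable {K L : Type*} [CommRing K] [Field L]

/-- The product `s (x + y) s (x - y)`, which for a function of the type of the Weierstrass sigma
function is the value at `(x, y)` of an alternating form of rank two. -/
def bracket (s : K → L) (x y : K) : L := s (x + y) * s (x - y)

theorem bracket_swap {s : K → L} (hs : ∀ x, s (-x) = -s x) (x y : K) :
    bracket s x y = -bracket s y x := by
  rw [bracket, bracket, ← neg_sub y x, hs, add_comm, mul_neg]

/-- An odd function satisfying the three-term relation of the Weierstrass sigma function, written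
as a Plücker relation between brackets. -/
structure SigmaLike (s : K → L) : Prop where
  neg : ∀ x, s (-x) = -s x
  pluecker : ∀ x y z w, bracket s x y * bracket s z w - bracket s x z * bracket s y w +
    bracket s x w * bracket s y z = 0

namespace SigmaLike

variable {s : K → L} (hs : SigmaLike s)

include hs

theorem sub_comm (x y : K) : s (x - y) = -s (y - x) := by
  rw [← hs.neg, neg_sub]

theorem bracket_neg_left (x y : K) : bracket s (-x) y = bracket s x y := by
  rw [bracket, bracket, ← neg_add', hs.neg, neg_add_eq_sub, hs.sub_comm, neg_mul_neg, mul_comm]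

theorem bracket_sub_left (x x' y : K) : bracket s (x - x') y = bracket s (x' - x) y := by
  rw [← hs.bracket_neg_left, neg_sub]

theorem bracket_eq_add {p q : K} (hpq : bracket s p q ≠ 0) (x y : K) :
    bracket s x y =
      bracket s x p / bracket s p q * bracket s y q +
        -bracket s x q / bracket s p q * bracket s y p := by
  have h := hs.pluecker x y p q
  field_simp
  linear_combination h

theorem zero [CharZero L] : s 0 = 0 :=
  self_eq_neg.mp (by simpa using hs.neg 0)

theorem bracket_self [CharZero L] (x : K) : bracket s x x = 0 := by
  rw [bracket, sub_self, hs.zero, mul_zero]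

end SigmaLike

/-- The difference of the two sides of the identity to which the symmetry of `kernelSum` reduces
when one of the arguments of the kernel vanishes. -/
def fourTerm (s : K → L) (A B D E y ν : K) : L :=
  s (2 * B) * (bracket s (A + D) ν * bracket s (A - D - E) B * bracket s (A + E) y -
      bracket s (A - D) ν * bracket s (A + D + E) B * bracket s (A - E) y) -
    s (2 * A) * (bracket s (B + E) ν * bracket s (B - E - D) A * bracket s (B + D) y -
      bracket s (B - E) ν * bracket s (B + E + D) A * bracket s (B - D) y)

variable {s : K → L} (hs : SigmaLike s) (A B D E y : K)

theorem fourTerm_swap (ν : K) : fourTerm s A B D E y ν = -fourTerm s B A E D y ν := by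
  rw [fourTerm, fourTerm, neg_sub]

include hs

theorem fourTerm_add_eq_zero [CharZero L] : fourTerm s A B D E y (A + D) = 0 := by
  have h1 : bracket s (A - D) (A + D) = -(s (2 * A) * s (2 * D)) := by
    rw [bracket, ← mul_neg, ← hs.neg]; ring_nf
  have h2 : bracket s (B + D) (B - D) = s (2 * B) * s (2 * D) := by
    rw [bracket]; ring_nf
  have h3 : bracket s (B + E) (A + D) * bracket s (B - E - D) A =
      bracket s (A + D + E) B * bracket s (A - E) (B - D) := by
    simp only [bracket]
    rw [show B + E - (A + D) = -(A - E - (B - D)) by ring,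
      show B - E - D - A = -(A + D + E - B) by ring, hs.neg, hs.neg]
    ring_nf
  have h4 : bracket s (B - E) (A + D) * bracket s (B + E + D) A =
      bracket s (A + D + E) B * bracket s (A - E) (B + D) := by
    simp only [bracket]
    rw [show B - E - (A + D) = -(A + D + E - B) by ring,
      show B + E + D - A = -(A - E - (B + D)) by ring, hs.neg, hs.neg]
    ring_nf
  have h := hs.pluecker (A - E) (B + D) (B - D) y
  rw [fourTerm, hs.bracket_self, h1, h3, h4]
  rw [h2] at h
  linear_combination s (2 * A) * bracket s (A + D + E) B * h

theorem fourTerm_eq_zero [CharZero L] (h : bracket s (A + D) (B + E) ≠ 0) (ν : K) :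
    fourTerm s A B D E y ν = 0 := by
  have hA := fourTerm_add_eq_zero hs A B D E y
  have hB : fourTerm s A B D E y (B + E) = 0 := by
    rw [fourTerm_swap, fourTerm_add_eq_zero hs, neg_zero]
  rw [fourTerm] at hA hB ⊢
  rw [hs.bracket_eq_add h (A + D) ν, hs.bracket_eq_add h (A - D) ν,
    hs.bracket_eq_add h (B + E) ν, hs.bracket_eq_add h (B - E) ν]
  linear_combination bracket s ν (B + E) / bracket s (A + D) (B + E) * hA -
    bracket s ν (A + D) / bracket s (A + D) (B + E) * hB

end SigmaLike

section KernelSum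

variable {K L : Type*} [CommRing K] [Field L]

/-- The summand of `kernelSum` for the entry `a` of the triple with entries `a`, `b`, `c`. -/
def kernelTerm (s : K → L) (ν a b c : K) (w z : Fin 3 → K) : L :=
  bracket s (b - c) ν / (s (a - b) * s (a - c)) * ∏ l, ∏ m, s (a + w l + z m)

/-- The result of applying the difference operator in `v` to the kernel function, up to a factor
symmetric in `v` and `w`, expressed through an odd function `s`. The parameter `ν` is the coupling
`μ` of the operator shifted by a half period. -/
def kernelSum (s : K → L) (ν : K) (v w z : Fin 3 → K) : L :=
  ∑ j, kernelTerm s ν (v j) (v (j + 1)) (v (j + 2)) w z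

/-- The triple with sum zero, first entry `2 * c` and remaining entries differing by `2 * y`. -/
def zeroSumTriple (c y : K) : Fin 3 → K := ![2 * c, y - c, -y - c]

section Symmetry

variable {s : K → L} (ν : K) (v w z : Fin 3 → K) (σ : Equiv.Perm (Fin 3))

theorem kernelSum_comp_second : kernelSum s ν v (w ∘ σ) z = kernelSum s ν v w z :=
  Finset.sum_congr rfl fun j _ => congrArg (_ * ·) <|
    Equiv.prod_comp σ fun l => ∏ m, s (v j + w l + z m)

theorem kernelSum_comp_third : kernelSum s ν v w (z ∘ σ) = kernelSum s ν v w z :=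
  Finset.sum_congr rfl fun j _ => congrArg (_ * ·) <| Finset.prod_congr rfl fun l _ =>
    Equiv.prod_comp σ fun m => s (v j + w l + z m)

variable (hs : SigmaLike s)

include hs

theorem kernelTerm_swap (a b c : K) : kernelTerm s ν a b c w z = kernelTerm s ν a c b w z := by
  rw [kernelTerm, kernelTerm, hs.bracket_sub_left, mul_comm (s (a - b))]

theorem kernelSum_comp_first : kernelSum s ν (v ∘ σ) w z = kernelSum s ν v w z := by
  have cyclic_or_anticyclic : ∀ (σ : Equiv.Perm (Fin 3)) (j : Fin 3),
      (σ (j + 1) = σ j + 1 ∧ σ (j + 2) = σ j + 2) ∨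
      (σ (j + 1) = σ j + 2 ∧ σ (j + 2) = σ j + 1) := by decide
  rw [kernelSum, kernelSum,
    ← Equiv.sum_comp σ fun j => kernelTerm s ν (v j) (v (j + 1)) (v (j + 2)) w z]
  refine Finset.sum_congr rfl fun j _ => ?_
  simp only [Function.comp_apply]
  rcases cyclic_or_anticyclic σ j with ⟨h1, h2⟩ | ⟨h1, h2⟩ <;> rw [h1, h2]
  exact kernelTerm_swap ν w z hs _ _ _

end Symmetry

variable {s : K → L}

theorem prod_add_zeroSumTriple (s : K → L) (x c y : K) :
    ∏ m, s (x + zeroSumTriple c y m) = s (x + 2 * c) * bracket s (x - c) y := by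
  rw [Fin.prod_univ_three, bracket, mul_assoc]
  simp only [zeroSumTriple, Matrix.cons_val]
  ring_nf

theorem kernelTerm_zeroSumTriple (s : K → L) (ν a b d : K) (w : Fin 3 → K) (c y : K) :
    kernelTerm s ν a b d w (zeroSumTriple c y) =
      bracket s (b - d) ν / (s (a - b) * s (a - d)) *
        ((∏ l, s (a + w l + 2 * c)) * ∏ l, bracket s (a + w l - c) y) := by
  simp only [kernelTerm, prod_add_zeroSumTriple, Finset.prod_mul_distrib]

theorem kernelSum_mem_binaryForms (hs : SigmaLike s) {p q : K} (hpq : bracket s p q ≠ 0) (ν : K)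
    (v w : Fin 3 → K) (c : K) :
    (fun y => kernelSum s ν v w (zeroSumTriple c y)) ∈
      binaryForms (fun y => bracket s y q) (fun y => bracket s y p) 3 := by
  have hlin (x : K) : bracket s x ∈
      binaryForms (fun y => bracket s y q) (fun y => bracket s y p) 1 := by
    rw [funext (hs.bracket_eq_add hpq x)]
    exact mul_add_mul_mem_binaryForms_one _ _
  simp only [kernelSum, kernelTerm_zeroSumTriple, ← mul_assoc]
  refine (congrArg (· ∈ _) (Finset.sum_fn _ _)).mp (Submodule.sum_mem _ fun j _ => ?_)
  exact Submodule.smul_mem _ (_ * _) (prod_mem_binaryForms_card fun l => hlin (v j + w l - c))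

variable (hs : SigmaLike s)

include hs

theorem kernelTerm_zeroSumTriple_neg_add (ν : K) {A D : K} (h : s (A - 3 * D) ≠ 0) (B E y : K) :
    kernelTerm s ν (A - D) (-A - D) (2 * D) (zeroSumTriple E B) (zeroSumTriple (-(D + E)) y) =
      bracket s (A + 3 * D) ν * bracket s (A - 3 * D - 3 * E) B * bracket s (A + 3 * E) y *
        (bracket s (A + B) y * bracket s (A - B) y) / s (2 * A) := by
  have hB : bracket s (A - 3 * D - 3 * E) B =
      s (A - 3 * D - 3 * E + B) * s (A - 3 * D - 3 * E - B) := rfl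
  rw [kernelTerm_zeroSumTriple, Fin.prod_univ_three, Fin.prod_univ_three,
    ← hs.bracket_neg_left (-A - D - 2 * D), hB]
  simp only [zeroSumTriple, Matrix.cons_val]
  ring_nf at h ⊢
  field_simp

variable [CharZero L]

theorem kernelTerm_eq_zero (ν a b c : K) {w z : Fin 3 → K} {l m : Fin 3} (h : a + w l + z m = 0) :
    kernelTerm s ν a b c w z = 0 := by
  rw [kernelTerm, Finset.prod_eq_zero (Finset.mem_univ l)
    (Finset.prod_eq_zero (Finset.mem_univ m) (by rw [h, hs.zero])), mul_zero]

theorem kernelSum_zeroSumTriple_neg_add (ν : K) {A D : K} (h : s (A - 3 * D) ≠ 0)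
    (h' : s (-A - 3 * D) ≠ 0) (B E y : K) :
    kernelSum s ν (zeroSumTriple D A) (zeroSumTriple E B) (zeroSumTriple (-(D + E)) y) =
      (bracket s (A + 3 * D) ν * bracket s (A - 3 * D - 3 * E) B * bracket s (A + 3 * E) y -
        bracket s (A - 3 * D) ν * bracket s (A + 3 * D + 3 * E) B * bracket s (A - 3 * E) y) *
        (bracket s (A + B) y * bracket s (A - B) y) / s (2 * A) := by
  have h0 : kernelTerm s ν (2 * D) (A - D) (-A - D) (zeroSumTriple E B)
      (zeroSumTriple (-(D + E)) y) = 0 := by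
    refine kernelTerm_eq_zero hs _ _ _ _ (l := 0) (m := 0) ?_
    simp only [zeroSumTriple, Matrix.cons_val_zero]
    ring
  have h1 := kernelTerm_zeroSumTriple_neg_add hs ν h B E y
  have h2 := kernelTerm_zeroSumTriple_neg_add hs ν h' B E y
  rw [neg_neg, mul_neg, hs.neg, ← hs.bracket_neg_left (-A + 3 * D),
    ← hs.bracket_neg_left (-A - 3 * D - 3 * E), ← hs.bracket_neg_left (-A + 3 * E),
    ← hs.bracket_neg_left (-A + B), ← hs.bracket_neg_left (-A - B)] at h2
  have hj : kernelSum s ν (zeroSumTriple D A) (zeroSumTriple E B) (zeroSumTriple (-(D + E)) y) =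
      kernelTerm s ν (2 * D) (A - D) (-A - D) (zeroSumTriple E B) (zeroSumTriple (-(D + E)) y) +
      kernelTerm s ν (A - D) (-A - D) (2 * D) (zeroSumTriple E B) (zeroSumTriple (-(D + E)) y) +
      kernelTerm s ν (-A - D) (2 * D) (A - D) (zeroSumTriple E B) (zeroSumTriple (-(D + E)) y) := by
    rw [kernelSum, Fin.sum_univ_three]; rfl
  rw [hj, h0, h1, kernelTerm_swap _ _ _ hs, h2]
  ring_nf

theorem kernelSum_zeroSumTriple_comm (ν : K) {A B D E : K} (hA : s (2 * A) ≠ 0)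
    (hA₁ : s (A - 3 * D) ≠ 0) (hA₂ : s (-A - 3 * D) ≠ 0)
    (hB : s (2 * B) ≠ 0) (hB₁ : s (B - 3 * E) ≠ 0) (hB₂ : s (-B - 3 * E) ≠ 0)
    (hAB : bracket s (A + 3 * D) (B + 3 * E) ≠ 0) (y : K) :
    kernelSum s ν (zeroSumTriple D A) (zeroSumTriple E B) (zeroSumTriple (-(D + E)) y) =
      kernelSum s ν (zeroSumTriple E B) (zeroSumTriple D A) (zeroSumTriple (-(D + E)) y) := by
  have h := fourTerm_eq_zero hs A B (3 * D) (3 * E) y hAB ν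
  rw [fourTerm] at h
  rw [kernelSum_zeroSumTriple_neg_add hs ν hA₁ hA₂, add_comm D E,
    kernelSum_zeroSumTriple_neg_add hs ν hB₁ hB₂, add_comm B A, hs.bracket_sub_left B A,
    div_eq_div_iff hA hB]
  linear_combination bracket s (A + B) y * bracket s (A - B) y * h

end KernelSum

section Generic

variable {K L : Type*} [Field K] [CharZero K] [Field L] [CharZero L]

theorem eq_zeroSumTriple {x : Fin 3 → K} (hx : ∑ j, x j = 0) :
    x = zeroSumTriple (x 0 / 2) ((x 1 - x 2) / 2) := by
  rw [Fin.sum_univ_three] at hx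
  funext j
  fin_cases j
  · change x 0 = 2 * (x 0 / 2)
    ring
  · change x 1 = (x 1 - x 2) / 2 - x 0 / 2
    linear_combination hx / 2
  · change x 2 = -((x 1 - x 2) / 2) - x 0 / 2
    linear_combination hx / 2

variable {s : K → L} (hs : SigmaLike s) (ν : K) {v w z : Fin 3 → K}
  (hv : ∑ j, v j = 0) (hw : ∑ j, w j = 0) (hz : ∑ j, z j = 0)
  (hvw : Pairwise fun p q : Fin 3 × Fin 3 => s (v p.1 + w p.2 - (v q.1 + w q.2)) ≠ 0)

include hs hv hw hz hvw

theorem kernelSum_comm_of_apply_zero_add_eq_zero (h0 : v 0 + w 0 + z 0 = 0) :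
    kernelSum s ν v w z = kernelSum s ν w v z := by
  have hv' (j k : Fin 3) (hjk : j ≠ k) : s (v j - v k) ≠ 0 := by
    simpa using hvw (i := (j, 0)) (j := (k, 0)) (by simpa using hjk)
  have hw' (j k : Fin 3) (hjk : j ≠ k) : s (w j - w k) ≠ 0 := by
    simpa using hvw (i := (0, j)) (j := (0, k)) (by simpa using hjk)
  have hv12 := hv' 1 2 (by decide)
  have hv10 := hv' 1 0 (by decide)
  have hv20 := hv' 2 0 (by decide)
  have hw12 := hw' 1 2 (by decide)
  have hw10 := hw' 1 0 (by decide)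
  have hw20 := hw' 2 0 (by decide)
  have h1 := hvw (i := (0, 0)) (j := (2, 2)) (by decide)
  have h2 := hvw (i := (0, 2)) (j := (2, 0)) (by decide)
  have hz0 : z 0 / 2 = -(v 0 / 2 + w 0 / 2) := by linear_combination h0 / 2
  rw [eq_zeroSumTriple hv, eq_zeroSumTriple hw, eq_zeroSumTriple hz, hz0]
  rw [Fin.sum_univ_three] at hv hw
  apply kernelSum_zeroSumTriple_comm hs
  · convert hv12 using 2; ring
  · convert hv10 using 2; linear_combination - hv / 2
  · convert hv20 using 2; linear_combination - hv / 2
  · convert hw12 using 2; ring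
  · convert hw10 using 2; linear_combination - hw / 2
  · convert hw20 using 2; linear_combination - hw / 2
  · rw [bracket]
    refine mul_ne_zero ?_ ?_
    · convert h1 using 2
      linear_combination hv / 2 + hw / 2
    · convert h2 using 2
      linear_combination hv / 2 - hw / 2

theorem kernelSum_comm_of_apply_add_eq_zero {k l m : Fin 3} (h0 : v k + w l + z m = 0) :
    kernelSum s ν v w z = kernelSum s ν w v z := by
  have hswap (x : Fin 3 → K) (j : Fin 3) (hx : ∑ i, x i = 0) :
      ∑ i, (x ∘ Equiv.swap 0 j) i = 0 := (Equiv.sum_comp (Equiv.swap 0 j) x).trans hx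
  have h := kernelSum_comm_of_apply_zero_add_eq_zero hs ν (hswap v k hv)
    (hswap w l hw) (hswap z m hz) (fun p q hpq => @hvw (Equiv.swap 0 k p.1, Equiv.swap 0 l p.2)
      (Equiv.swap 0 k q.1, Equiv.swap 0 l q.2) (by simpa [Prod.ext_iff] using hpq)) (by simpa)
  simpa only [kernelSum_comp_first _ _ _ _ _ hs, kernelSum_comp_second, kernelSum_comp_third]
    using h

theorem kernelSum_comm_of_generic
    (hvwz : Pairwise fun p q : Fin 3 × Fin 3 =>
      s (z 0 - (v p.1 + w p.2) - (v q.1 + w q.2)) ≠ 0) :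
    kernelSum s ν v w z = kernelSum s ν w v z := by
  -- For these values of `y` some argument of the kernel at `zeroSumTriple (z 0 / 2) y` vanishes.
  let Y (p : Fin 3 × Fin 3) : K := z 0 / 2 - (v p.1 + w p.2)
  have hY : Pairwise fun p q => bracket s (Y p) (Y q) ≠ 0 := fun p q hpq => by
    refine mul_ne_zero ?_ ?_
    · convert hvwz hpq using 2
      simp only [Y]; ring
    · convert hvw hpq.symm using 2
      simp only [Y]; ring
  have h01 : bracket s (Y (0, 0)) (Y (0, 1)) ≠ 0 := hY (by decide)
  have hform := Submodule.sub_mem _ (kernelSum_mem_binaryForms hs h01 ν v w (z 0 / 2))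
    (kernelSum_mem_binaryForms hs h01 ν w v (z 0 / 2))
  have hzero := eq_zero_of_mem_binaryForms hform (by decide) (Y := Y) (fun p q hpq => ?_)
    (fun p => ?_)
  · rw [eq_zeroSumTriple hz]
    exact sub_eq_zero.mp (congrFun hzero _)
  · intro h
    have h' := hs.pluecker (Y p) (Y q) (Y (0, 0)) (Y (0, 1))
    exact mul_ne_zero (hY hpq) h01 (by linear_combination h' - h)
  · refine sub_eq_zero.mpr (kernelSum_comm_of_apply_add_eq_zero hs ν hv hw ?_ hvw
      (k := p.1) (l := p.2) (m := 1) ?_)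
    · simp only [zeroSumTriple, Fin.sum_univ_three, Matrix.cons_val]
      ring
    · simp only [zeroSumTriple, Matrix.cons_val, Y]
      ring

end Generic

section Deformation

open Filter Topology

variable {s : ℂ → ℂ}

theorem eventually_add_mul_ne_zero (hd : Differentiable ℂ s) {x₀ : ℂ} (hx₀ : s x₀ ≠ 0) (α : ℂ)
    {β : ℂ} (hβ : β ≠ 0) : ∀ᶠ t in 𝓝[≠] (0 : ℂ), s (α + t * β) ≠ 0 := by
  have hg : Differentiable ℂ fun t => s (α + t * β) := by fun_prop
  refine (hg.analyticAt 0).eventually_eq_zero_or_eventually_ne_zero.resolve_left fun h => hx₀ ?_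
  have := congrFun (AnalyticOnNhd.eq_of_eventuallyEq (fun t _ => hg.analyticAt t)
    (fun _ _ => analyticAt_const) h) ((x₀ - α) / β)
  simpa [hβ] using this

theorem continuousAt_kernelSum (hc : Continuous s) (ν : ℂ) {v w z : ℂ → Fin 3 → ℂ}
    (hv : Continuous v) (hw : Continuous w) (hz : Continuous z) {t : ℂ}
    (h : ∀ j k, j ≠ k → s (v t j - v t k) ≠ 0) :
    ContinuousAt (fun t => kernelSum s ν (v t) (w t) (z t)) t := by
  simp only [kernelSum, kernelTerm, bracket]
  refine tendsto_finsetSum _ fun j _ => ContinuousAt.mul (ContinuousAt.div ?_ ?_ ?_) ?_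
  · fun_prop
  · fun_prop
  · exact mul_ne_zero (h _ _ (by revert j; decide)) (h _ _ (by revert j; decide))
  · fun_prop

theorem eventually_pairwise_sub_ne_zero (hd : Differentiable ℂ s) {v : Fin 3 → ℂ}
    (hv : ∀ j k, j ≠ k → s (v j - v k) ≠ 0) (w : Fin 3 → ℂ) {d : Fin 3 → ℂ}
    (hinj : Function.Injective d) :
    ∀ᶠ t in 𝓝[≠] (0 : ℂ), Pairwise fun p q : Fin 3 × Fin 3 =>
      s (v p.1 + (w p.2 + t * d p.2) - (v q.1 + (w q.2 + t * d q.2))) ≠ 0 := by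
  refine eventually_all.mpr fun p => eventually_all.mpr fun q =>
    eventually_imp_distrib_left.mpr fun hpq => ?_
  by_cases h : p.2 = q.2
  · have := hv p.1 q.1 fun h' => hpq (Prod.ext h' h)
    exact .of_forall fun t => by simpa [h] using this
  · filter_upwards [eventually_add_mul_ne_zero hd (hv 0 1 (by decide))
      (v p.1 + w p.2 - (v q.1 + w q.2)) (sub_ne_zero.mpr (hinj.ne h))] with t ht
    convert ht using 2
    ring

theorem eventually_pairwise_sub_sub_ne_zero (hd : Differentiable ℂ s) {x₀ : ℂ} (hx₀ : s x₀ ≠ 0)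
    (v w : Fin 3 → ℂ) (c : ℂ) {d : Fin 3 → ℂ} {e : ℂ} (he : ∀ j k, e - d j - d k ≠ 0) :
    ∀ᶠ t in 𝓝[≠] (0 : ℂ), Pairwise fun p q : Fin 3 × Fin 3 =>
      s (c + t * e - (v p.1 + (w p.2 + t * d p.2)) - (v q.1 + (w q.2 + t * d q.2))) ≠ 0 := by
  refine eventually_all.mpr fun p => eventually_all.mpr fun q => ?_
  filter_upwards [eventually_add_mul_ne_zero hd hx₀
    (c - (v p.1 + w p.2) - (v q.1 + w q.2)) (he p.2 q.2)] with t ht _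
  convert ht using 2
  ring

theorem kernelSum_comm (hs : SigmaLike s) (hd : Differentiable ℂ s) (ν : ℂ) {v w z : Fin 3 → ℂ}
    (hv : ∑ j, v j = 0) (hw : ∑ j, w j = 0) (hz : ∑ j, z j = 0)
    (hv' : ∀ j k, j ≠ k → s (v j - v k) ≠ 0) (hw' : ∀ j k, j ≠ k → s (w j - w k) ≠ 0) :
    kernelSum s ν v w z = kernelSum s ν w v z := by
  let d (j : Fin 3) : ℂ := (![1, -1, 0] : Fin 3 → ℤ) j
  let W (t : ℂ) (j : Fin 3) : ℂ := w j + t * d j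
  let Z (t : ℂ) (j : Fin 3) : ℂ := z j + t * (3 * d j)
  have hd_inj : Function.Injective d := Int.cast_injective.comp (by decide)
  have hd_sum : ∑ j, d j = 0 := by simp [d, Fin.sum_univ_three]
  have hd_ne : ∀ j k, 3 * d 0 - d j - d k ≠ 0 := by
    simp only [d]
    norm_cast
  have hcomm : (fun t => kernelSum s ν v (W t) (Z t)) =ᶠ[𝓝[≠] 0]
      fun t => kernelSum s ν (W t) v (Z t) := by
    filter_upwards [eventually_pairwise_sub_ne_zero hd hv' w hd_inj,
      eventually_pairwise_sub_sub_ne_zero hd (hv' 0 1 (by decide)) v w (z 0) hd_ne] with t h1 h2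
    refine kernelSum_comm_of_generic hs ν hv ?_ ?_ h1 h2
    · simp only [W, Finset.sum_add_distrib, hw, ← Finset.mul_sum, hd_sum, mul_zero, add_zero]
    · simp only [Z, Finset.sum_add_distrib, hz, ← Finset.mul_sum, hd_sum, mul_zero, add_zero]
  have hW0 : W 0 = w := by funext j; simp [W]
  have hZ0 : Z 0 = z := by funext j; simp [Z]
  have hW : Continuous W := by fun_prop
  have hZ : Continuous Z := by fun_prop
  have hl := continuousAt_kernelSum hd.continuous ν (v := fun _ => v) (t := 0) continuous_const
    hW hZ hv'
  have hr := continuousAt_kernelSum hd.continuous ν (w := fun _ => v) (t := 0) hW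
    continuous_const hZ (by rwa [hW0])
  simpa only [hW0, hZ0] using tendsto_nhds_unique_of_eventuallyEq
    (hl.mono_left nhdsWithin_le_nhds) (hr.mono_left nhdsWithin_le_nhds) hcomm

end Deformation

section ThetaSpace

open Filter Topology
open scoped Real

variable {N : ℕ} {T a : ℝ} {C : ℂ} {f : ℂ → ℂ}

/-- The entire theta functions of degree `N` and real period `T`, with multiplier
`C * exp (-(2 * π * I * N * x / T))` for the imaginary quasi-period `a * I`. -/
def thetaSpace (N : ℕ) (T a : ℝ) (C : ℂ) : Submodule ℂ (ℂ → ℂ) where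
  carrier := {f | Differentiable ℂ f ∧ (∀ x, f (x + T) = f x) ∧
    ∀ x, f (x + a * I) = C * exp (-(2 * π * I * N * x / T)) * f x}
  add_mem' := fun ⟨hf, hfT, hfa⟩ ⟨hg, hgT, hga⟩ =>
    ⟨hf.add hg, fun x => by simp only [Pi.add_apply, hfT, hgT],
      fun x => by simp only [Pi.add_apply, hfa, hga, mul_add]⟩
  zero_mem' := ⟨differentiable_const 0, by simp⟩
  smul_mem' := fun c f ⟨hf, hfT, hfa⟩ =>
    ⟨hf.const_smul c, fun x => by simp only [Pi.smul_apply, hfT],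
      fun x => by simp only [Pi.smul_apply, hfa, smul_eq_mul, mul_left_comm]⟩

/-- The `n`-th Fourier coefficient, up to the factor `T`, of the restriction of a `T`-periodic
function to the real line. -/
def fourierIntegral (T : ℝ) (n : ℤ) (f : ℂ → ℂ) : ℂ :=
  ∫ x : ℝ in 0..T, exp (-(2 * π * I * n * x / T)) * f x

theorem integral_add_mul_I_eq {g : ℂ → ℂ} (hg : Differentiable ℂ g) (hgT : ∀ x, g (x + T) = g x)
    (a : ℝ) : ∫ x : ℝ in 0..T, g (x + a * I) = ∫ x : ℝ in 0..T, g x := by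
  have h := integral_boundary_rect_eq_zero_of_differentiableOn g 0 (T + a * I) hg.differentiableOn
  have hside (y : ℝ) : g (T + y * I) = g (y * I) := by rw [add_comm, hgT]
  simp only [zero_re, zero_im, add_re, ofReal_re, mul_re, I_re, mul_zero, ofReal_im, I_im,
    mul_one, sub_self, add_zero, add_im, mul_im, zero_add, ofReal_zero, zero_mul, hside] at h
  linear_combination -h

theorem fourierIntegral_eq_mul_fourierIntegral_add (hT : T ≠ 0) (hf : f ∈ thetaSpace N T a C)
    (n : ℤ) : fourierIntegral T n f =
      C * exp (2 * π * n * a / T) * fourierIntegral T (n + N) f := by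
  obtain ⟨hfd, hfT, hfa⟩ := hf
  have hT' : (T : ℂ) ≠ 0 := ofReal_ne_zero.mpr hT
  let g (x : ℂ) : ℂ := exp (-(2 * π * I * n * x / T)) * f x
  have hg : Differentiable ℂ g := by fun_prop
  have hgT (x : ℂ) : g (x + T) = g x := by
    have harg : -(2 * π * I * n * (x + T) / T) = -(2 * π * I * n * x / T) - n * (2 * π * I) := by
      field_simp
      ring
    simp only [g]
    rw [hfT, harg, exp_periodic.sub_int_mul_eq]
  change ∫ x : ℝ in 0..T, g x = _
  rw [← integral_add_mul_I_eq hg hgT a, fourierIntegral, ← intervalIntegral.integral_const_mul]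
  congr 1 with x
  have hexp : exp (-(2 * π * I * n * (x + a * I) / T)) * exp (-(2 * π * I * N * x / T)) =
      exp (2 * π * n * a / T) * exp (-(2 * π * I * (n + N : ℤ) * x / T)) := by
    rw [← exp_add, ← exp_add]
    congr 1
    push_cast
    linear_combination -(2 * π * n * a / T : ℂ) * I_sq
  simp only [g, hfa]
  linear_combination C * f x * hexp

theorem fourierIntegral_eq_zero_of_forall_lt (hT : T ≠ 0) (hC : C ≠ 0) (hN : N ≠ 0)
    (hf : f ∈ thetaSpace N T a C) (h0 : ∀ i < N, fourierIntegral T i f = 0) (n : ℤ) :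
    fourierIntegral T n f = 0 := by
  have hper : Function.Periodic (fun n => fourierIntegral T n f = 0) (N : ℤ) := fun n => by
    simp only
    rw [fourierIntegral_eq_mul_fourierIntegral_add hT hf n]
    simp [hC, exp_ne_zero]
  have hN' : (0 : ℤ) < N := by positivity
  obtain ⟨i, hi⟩ := Int.eq_ofNat_of_zero_le (Int.emod_nonneg n hN'.ne')
  have := h0 i (by have := Int.emod_lt_of_pos n hN'; omega)
  rw [← hi, Int.emod_def, mul_comm] at this
  exact (hper.sub_int_mul_eq _).mp this

theorem eq_zero_of_fourierIntegral_eq_zero (hT : 0 < T) (hf : Continuous f)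
    (hfT : ∀ x, f (x + T) = f x) (h0 : ∀ n, fourierIntegral T n f = 0) (x : ℝ) : f x = 0 := by
  have : Fact (0 < T) := ⟨hT⟩
  have hper : Function.Periodic (fun x : ℝ => f x) T := fun x => by simp only [ofReal_add, hfT]
  let F : C(AddCircle T, ℂ) :=
    ⟨hper.lift, continuous_coinduced_dom.mpr (hf.comp continuous_ofReal)⟩
  have hF : fourierCoeff F = 0 := by
    funext n
    rw [fourierCoeff_eq_intervalIntegral _ n 0, zero_add]
    refine smul_eq_zero_of_right _ (Eq.trans ?_ (h0 n))
    refine intervalIntegral.integral_congr fun y _ => ?_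
    rw [fourier_coe_apply, smul_eq_mul]
    change _ * f y = _ * f y
    congr 2
    push_cast
    ring
  have hsum := has_pointwise_sum_fourier_series_of_summable (f := F) (hF ▸ summable_zero) x
  simp only [hF, Pi.zero_apply, zero_smul] at hsum
  exact hsum.unique hasSum_zero

theorem eq_zero_of_forall_ofReal_eq_zero (hf : Differentiable ℂ f) (h0 : ∀ x : ℝ, f x = 0) :
    f = 0 := by
  have hreal : Tendsto ((↑) : ℝ → ℂ) (𝓝[≠] 0) (𝓝[≠] 0) :=
    continuous_ofReal.continuousAt.continuousWithinAt.tendsto_nhdsWithin fun x => by simp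
  exact AnalyticOnNhd.eq_of_frequently_eq (fun z _ => hf.analyticAt z)
    (fun _ _ => analyticAt_const) (hreal.frequently (Eventually.of_forall h0).frequently)

/-- The first `N` Fourier integrals, which determine a theta function of degree `N`. -/
def thetaCoeffs (N : ℕ) (T a : ℝ) (C : ℂ) : thetaSpace N T a C →ₗ[ℂ] Fin N → ℂ where
  toFun f i := fourierIntegral T i f
  map_add' f g := by
    funext i
    have hf := f.2.1.continuous
    have hg := g.2.1.continuous
    simp only [fourierIntegral, Submodule.coe_add, Pi.add_apply, mul_add]
    exact intervalIntegral.integral_add (Continuous.intervalIntegrable (by fun_prop) _ _)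
      (Continuous.intervalIntegrable (by fun_prop) _ _)
  map_smul' c f := by
    funext i
    simp only [fourierIntegral, SetLike.val_smul, Pi.smul_apply, smul_eq_mul, RingHom.id_apply,
      mul_left_comm, intervalIntegral.integral_const_mul]

theorem thetaCoeffs_injective (hT : 0 < T) (hC : C ≠ 0) (hN : N ≠ 0) :
    Function.Injective (thetaCoeffs N T a C) := by
  refine (injective_iff_map_eq_zero _).mpr fun f hf => Subtype.ext ?_
  exact eq_zero_of_forall_ofReal_eq_zero f.2.1 <|
    eq_zero_of_fourierIntegral_eq_zero hT f.2.1.continuous f.2.2.1 <|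
      fourierIntegral_eq_zero_of_forall_lt hT.ne' hC hN f.2 fun i hi => congrFun hf ⟨i, hi⟩

theorem not_linearIndependent_thetaSpace {ι : Type*} [Fintype ι] (hT : 0 < T) (hC : C ≠ 0)
    (hN : N ≠ 0) (hι : N < Fintype.card ι) {f : ι → ℂ → ℂ} (hf : ∀ i, f i ∈ thetaSpace N T a C) :
    ¬LinearIndependent ℂ f := fun h => by
  have h' : LinearIndependent ℂ fun i => (⟨f i, hf i⟩ : thetaSpace N T a C) :=
    .of_comp (thetaSpace N T a C).subtype h
  have := (h'.map' _ (LinearMap.ker_eq_bot.mpr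
    (thetaCoeffs_injective hT hC hN))).fintype_card_le_finrank
  rw [Module.finrank_fin_fun] at this
  omega

end ThetaSpace

section Pluecker

theorem pluecker_of_not_linearIndependent {X L : Type*} [Field L] {φ : X → X → L}
    (hself : ∀ x, φ x x = 0) (hswap : ∀ x y, φ x y = -φ y x) {y z w : X}
    (hdep : ¬LinearIndependent L ![fun x => φ x y, fun x => φ x z, fun x => φ x w]) (x : X) :
    φ x y * φ z w - φ x z * φ y w + φ x w * φ y z = 0 := by
  obtain ⟨c, hc, k, hk⟩ := Fintype.not_linearIndependent_iff.mp hdep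
  have heval (x : X) : c 0 * φ x y + c 1 * φ x z + c 2 * φ x w = 0 := by
    simpa [Fin.sum_univ_three] using congrFun hc x
  have hx := heval x
  have hy := heval y
  have hz := heval z
  have hw := heval w
  rw [hself] at hy hz hw
  rw [hswap z y] at hz
  rw [hswap w y, hswap w z] at hw
  refine (mul_eq_zero.mp ?_).resolve_left hk
  fin_cases k
  · dsimp
    linear_combination φ z w * hx + φ x z * hw - φ x w * hz
  · dsimp
    linear_combination -φ y w * hx - φ x y * hw + φ x w * hy
  · dsimp
    linear_combination φ y z * hx + φ x y * hz - φ x z * hy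

theorem sigmaLike_of_bracket_mem_thetaSpace {s : ℂ → ℂ} (hs : ∀ x, s (-x) = -s x) {T a : ℝ}
    (hT : 0 < T) {C : ℂ} (hC : C ≠ 0)
    (hmem : ∀ y, (fun x => bracket s x y) ∈ thetaSpace 2 T a C) : SigmaLike s where
  neg := hs
  pluecker x y z w := by
    refine pluecker_of_not_linearIndependent (fun x => self_eq_neg.mp (bracket_swap hs x x))
      (bracket_swap hs)
      (not_linearIndependent_thetaSpace (a := a) hT hC two_ne_zero (by decide) fun i => ?_) x
    fin_cases i
    exacts [hmem y, hmem z, hmem w]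

end Pluecker

section Theta

open scoped Real

/-- The infinite `q`-Pochhammer symbol `(x; q)_∞`. -/
def qPochhammer (q x : ℂ) : ℂ := ∏' k : ℕ, (1 - x * q ^ k)

variable {q : ℂ}

theorem multipliable_qPochhammer (hq : ‖q‖ < 1) (x : ℂ) :
    Multipliable fun k : ℕ => 1 - x * q ^ k := by
  simp only [sub_eq_add_neg]
  refine multipliable_one_add_of_summable ?_
  simp only [norm_neg, norm_mul, norm_pow]
  exact (summable_geometric_of_lt_one (norm_nonneg _) hq).mul_left _

theorem qPochhammer_eq_mul (hq : ‖q‖ < 1) (x : ℂ) :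
    qPochhammer q x = (1 - x) * qPochhammer q (x * q) := by
  have hsucc (k : ℕ) : 1 - x * q ^ (k + 1) = 1 - x * q * q ^ k := by ring
  rw [qPochhammer,
    tprod_eq_zero_mul' (by simpa only [hsucc] using multipliable_qPochhammer hq (x * q))]
  simp only [hsucc, pow_zero, mul_one, qPochhammer]

theorem differentiable_qPochhammer (hq : ‖q‖ < 1) : Differentiable ℂ (qPochhammer q) := by
  intro x
  have hprod : HasProdLocallyUniformlyOn (fun (k : ℕ) (y : ℂ) => 1 + -(y * q ^ k))
      (fun y => ∏' k : ℕ, (1 + -(y * q ^ k))) (Metric.ball 0 (‖x‖ + 1)) := by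
    refine Summable.hasProdLocallyUniformlyOn_nat_one_add Metric.isOpen_ball
      ((summable_geometric_of_lt_one (norm_nonneg _) hq).mul_left (‖x‖ + 1))
      (.of_forall fun k y hy => ?_) (fun k => by fun_prop)
    rw [norm_neg, norm_mul, norm_pow]
    have := (mem_ball_zero_iff.mp hy).le
    gcongr
  simp only [← sub_eq_add_neg] at hprod
  refine (hprod.differentiableOn (.of_forall fun t => ?_) Metric.isOpen_ball).differentiableAt
    (Metric.isOpen_ball.mem_nhds (by simp))
  simpa only [Finset.prod_fn] using DifferentiableOn.finsetProd fun _ _ => by fun_prop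

variable {r α : ℝ}

theorem norm_exp_lt_one (hr : 0 < r) (hα : 0 < α) : ‖exp (-2 * α * r)‖ < 1 := by
  have : 0 < α * r := mul_pos hα hr
  rw [norm_exp, Real.exp_lt_one_iff]
  simpa [mul_assoc] using this

theorem R_eq_qPochhammer (hr : 0 < r) (hα : 0 < α) (z : ℂ) :
    R r α z = qPochhammer (exp (-2 * α * r)) (exp (2 * I * r * z - α * r)) *
      qPochhammer (exp (-2 * α * r)) (exp (-2 * I * r * z - α * r)) := by
  have hq := norm_exp_lt_one hr hα
  rw [qPochhammer, qPochhammer,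
    ← (multipliable_qPochhammer hq _).tprod_mul (multipliable_qPochhammer hq _), R]
  refine tprod_congr fun k => ?_
  rw [← exp_nat_mul, ← exp_add, ← exp_add]
  ring_nf

theorem differentiable_R (hr : 0 < r) (hα : 0 < α) : Differentiable ℂ (R r α) := by
  have := differentiable_qPochhammer (norm_exp_lt_one hr hα)
  rw [funext (R_eq_qPochhammer hr hα)]
  fun_prop

theorem R_neg (r α : ℝ) (z : ℂ) : R r α (-z) = R r α z :=
  tprod_congr fun k => by
    rw [mul_comm]
    simp only [neg_mul, mul_neg, neg_neg]

theorem R_add_pi_div (hr : r ≠ 0) (α : ℝ) (z : ℂ) : R r α (z + (π / r : ℝ)) = R r α z := by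
  have hr' : (r : ℂ) ≠ 0 := ofReal_ne_zero.mpr hr
  refine tprod_congr fun k => ?_
  have h₁ : 2 * I * r * (z + (π / r : ℝ)) - (2 * k + 1) * α * r =
      2 * I * r * z - (2 * k + 1) * α * r + 2 * π * I := by
    push_cast
    field_simp
    ring
  have h₂ : -2 * I * r * (z + (π / r : ℝ)) - (2 * k + 1) * α * r =
      -2 * I * r * z - (2 * k + 1) * α * r - 2 * π * I := by
    push_cast
    field_simp
    ring
  rw [h₁, h₂, exp_periodic, exp_periodic.sub_eq]

theorem R_add_half (hr : 0 < r) (hα : 0 < α) (z : ℂ) :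
    R r α (z + I * α / 2) = -exp (-2 * I * r * z) * R r α (z - I * α / 2) := by
  have hq := norm_exp_lt_one hr hα
  set q := exp (-2 * α * r)
  have h₁ : exp (2 * I * r * (z + I * α / 2) - α * r) = exp (2 * I * r * z) * q := by
    rw [← exp_add]; congr 1; linear_combination (r * α : ℂ) * I_sq
  have h₂ : exp (-2 * I * r * (z + I * α / 2) - α * r) = exp (-2 * I * r * z) := by
    congr 1; linear_combination (-r * α : ℂ) * I_sq
  have h₃ : exp (2 * I * r * (z - I * α / 2) - α * r) = exp (2 * I * r * z) := by
    congr 1; linear_combination (-r * α : ℂ) * I_sq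
  have h₄ : exp (-2 * I * r * (z - I * α / 2) - α * r) = exp (-2 * I * r * z) * q := by
    rw [← exp_add]; congr 1; linear_combination (r * α : ℂ) * I_sq
  have hinv : exp (-2 * I * r * z) * exp (2 * I * r * z) = 1 := by
    rw [← exp_add, ← exp_zero]; ring_nf
  rw [R_eq_qPochhammer hr hα, R_eq_qPochhammer hr hα, h₁, h₂, h₃, h₄,
    qPochhammer_eq_mul hq (exp (2 * I * r * z)), qPochhammer_eq_mul hq (exp (-2 * I * r * z))]
  linear_combination (-qPochhammer q (exp (2 * I * r * z) * q) *
    qPochhammer q (exp (-2 * I * r * z) * q)) * hinv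

/-- The odd theta function obtained from `R` by a shift over half an imaginary period, which up to
a constant and a Gaussian factor is the Weierstrass sigma function with periods `π / r` and
`I * α`. -/
def sigma (r α : ℝ) (x : ℂ) : ℂ := exp (-I * r * x) * R r α (x - I * α / 2)

theorem R_sub_half (r α : ℝ) (x : ℂ) :
    R r α (x - I * α / 2) = exp (I * r * x) * sigma r α x := by
  rw [sigma, ← mul_assoc, ← exp_add, neg_mul, neg_mul, add_neg_cancel, exp_zero, one_mul]

theorem R_add_half_eq_sigma (hr : 0 < r) (hα : 0 < α) (x : ℂ) :
    R r α (x + I * α / 2) = -exp (-I * r * x) * sigma r α x := by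
  have hexp : exp (-2 * I * r * x) = exp (-I * r * x) * exp (-I * r * x) := by
    rw [← exp_add]
    ring_nf
  rw [R_add_half hr hα, sigma, hexp]
  ring

theorem differentiable_sigma (hr : 0 < r) (hα : 0 < α) : Differentiable ℂ (sigma r α) := by
  have := differentiable_R hr hα
  unfold sigma
  fun_prop

theorem sigma_neg (hr : 0 < r) (hα : 0 < α) (x : ℂ) : sigma r α (-x) = -sigma r α x := by
  have hexp : exp (-I * r * -x) * exp (-I * r * x) = 1 := by
    rw [← exp_add, ← exp_zero]
    ring_nf
  rw [sigma, ← neg_add', R_neg, R_add_half_eq_sigma hr hα]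
  linear_combination -sigma r α x * hexp

theorem sigma_add_pi_div (hr : r ≠ 0) (α : ℝ) (x : ℂ) :
    sigma r α (x + (π / r : ℝ)) = -sigma r α x := by
  have hr' : (r : ℂ) ≠ 0 := ofReal_ne_zero.mpr hr
  have hexp : -I * r * (x + (π / r : ℝ)) = -I * r * x - π * I := by
    push_cast
    field_simp
    ring
  rw [sigma, sigma, hexp, exp_sub_pi_mul_I, add_sub_right_comm, R_add_pi_div hr, neg_mul]

theorem sigma_add_mul_I (hr : 0 < r) (hα : 0 < α) (x : ℂ) :
    sigma r α (x + α * I) = -(exp (α * r) * exp (-2 * I * r * x)) * sigma r α x := by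
  have hhalf : x + α * I - I * α / 2 = x + I * α / 2 := by ring
  have hexp : exp (-I * r * (x + α * I)) * exp (-I * r * x) =
      exp (α * r) * exp (-2 * I * r * x) := by
    rw [← exp_add, ← exp_add]
    congr 1
    linear_combination (-r * α : ℂ) * I_sq
  rw [sigma, hhalf, R_add_half_eq_sigma hr hα]
  linear_combination -sigma r α x * hexp

theorem bracket_sigma_mem_thetaSpace (hr : 0 < r) (hα : 0 < α) (y : ℂ) :
    (fun x => bracket (sigma r α) x y) ∈ thetaSpace 2 (π / r) α (exp (2 * α * r)) := by
  have := differentiable_sigma hr hα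
  refine ⟨by unfold bracket; fun_prop, fun x => ?_, fun x => ?_⟩
  · simp only [bracket]
    rw [add_right_comm, add_sub_right_comm, sigma_add_pi_div hr.ne', sigma_add_pi_div hr.ne',
      neg_mul_neg]
  · have hα' : exp (α * r) * exp (α * r) = exp (2 * α * r) := by
      rw [← exp_add]
      ring_nf
    have hx : exp (-2 * I * r * (x + y)) * exp (-2 * I * r * (x - y)) =
        exp (-(2 * π * I * (2 : ℕ) * x / (π / r : ℝ))) := by
      have : (π : ℂ) ≠ 0 := ofReal_ne_zero.mpr Real.pi_ne_zero
      rw [← exp_add]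
      push_cast
      field_simp
      ring_nf
    simp only [bracket]
    rw [add_right_comm, add_sub_right_comm, sigma_add_mul_I hr hα, sigma_add_mul_I hr hα, ← hα',
      ← hx]
    ring

theorem sigmaLike_sigma (hr : 0 < r) (hα : 0 < α) : SigmaLike (sigma r α) :=
  sigmaLike_of_bracket_mem_thetaSpace (sigma_neg hr hα) (div_pos Real.pi_pos hr) (exp_ne_zero _)
    (bracket_sigma_mem_thetaSpace hr hα)

end Theta

section EllipticGamma

/-- The infinite double product `∏ (1 - x p ^ m q ^ n)` over `m, n ≥ 0`, the analogue of
`qPochhammer` with two nomes. -/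
def doubleQPochhammer (p q x : ℂ) : ℂ := ∏' k : ℕ × ℕ, (1 - x * p ^ k.1 * q ^ k.2)

variable {p q : ℂ}

theorem summable_norm_doubleQPochhammer (hp : ‖p‖ < 1) (hq : ‖q‖ < 1) (x : ℂ) :
    Summable fun k : ℕ × ℕ => ‖-(x * p ^ k.1 * q ^ k.2)‖ := by
  simp only [norm_neg, norm_mul, norm_pow, mul_assoc]
  exact ((summable_geometric_of_lt_one (norm_nonneg _) hp).mul_of_nonneg
    (summable_geometric_of_lt_one (norm_nonneg _) hq) (fun _ => by positivity)
    (fun _ => by positivity)).mul_left _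

theorem multipliable_doubleQPochhammer (hp : ‖p‖ < 1) (hq : ‖q‖ < 1) (x : ℂ) :
    Multipliable fun k : ℕ × ℕ => 1 - x * p ^ k.1 * q ^ k.2 := by
  simpa only [sub_eq_add_neg] using
    multipliable_one_add_of_summable (summable_norm_doubleQPochhammer hp hq x)

theorem doubleQPochhammer_ne_zero (hp : ‖p‖ < 1) (hq : ‖q‖ < 1) {x : ℂ}
    (h : ∀ m n : ℕ, 1 - x * p ^ m * q ^ n ≠ 0) : doubleQPochhammer p q x ≠ 0 := by
  simp only [doubleQPochhammer, sub_eq_add_neg] at h ⊢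
  exact tprod_one_add_ne_zero_of_summable (fun k => h k.1 k.2)
    (summable_norm_doubleQPochhammer hp hq x)

theorem hasProd_doubleQPochhammer (hp : ‖p‖ < 1) (hq : ‖q‖ < 1) (x : ℂ) :
    HasProd (fun n : ℕ => qPochhammer p (x * q ^ n)) (doubleQPochhammer p q x) := by
  refine ((Equiv.prodComm ℕ ℕ).hasProd_iff.mpr
    (multipliable_doubleQPochhammer hp hq x).hasProd).prod_fiberwise fun n => ?_
  convert (multipliable_qPochhammer hp (x * q ^ n)).hasProd using 2 with k
  · exact congrArg (1 - ·) (mul_right_comm _ _ _)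
  · rfl

theorem doubleQPochhammer_eq_mul (hp : ‖p‖ < 1) (hq : ‖q‖ < 1) (x : ℂ) :
    doubleQPochhammer p q x = qPochhammer p x * doubleQPochhammer p q (x * q) := by
  have hsucc (n : ℕ) : x * q ^ (n + 1) = x * q * q ^ n := by ring
  have h := hasProd_doubleQPochhammer hp hq (x * q)
  rw [← (hasProd_doubleQPochhammer hp hq x).tprod_eq, ← h.tprod_eq,
    tprod_eq_zero_mul' (by simpa only [hsucc] using h.multipliable)]
  simp only [hsucc, pow_zero, mul_one]

variable {r ap am : ℝ}

theorem exp_eq_mul_pow_mul_pow (r ap am : ℝ) (x : ℂ) (m n : ℕ) :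
    exp (-(2 * m + 1) * r * ap - (2 * n + 1) * r * am + x) =
      exp (-r * ap - r * am + x) * exp (-2 * ap * r) ^ m * exp (-2 * am * r) ^ n := by
  rw [← exp_nat_mul, ← exp_nat_mul, ← exp_add, ← exp_add]
  ring_nf

theorem doubleQPochhammer_ne_zero_of_gRegular (hr : 0 < r) (hap : 0 < ap) (ham : 0 < am) {z : ℂ}
    (h : GRegular r ap am z) :
    doubleQPochhammer (exp (-2 * ap * r)) (exp (-2 * am * r))
      (exp (-r * ap - r * am + 2 * I * r * z)) ≠ 0 :=
  doubleQPochhammer_ne_zero (norm_exp_lt_one hr hap) (norm_exp_lt_one hr ham) fun m n => by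
    rw [← exp_eq_mul_pow_mul_pow]
    exact h m n

theorem G_eq_div (hr : 0 < r) (hap : 0 < ap) (ham : 0 < am) {z : ℂ}
    (h : doubleQPochhammer (exp (-2 * ap * r)) (exp (-2 * am * r))
      (exp (-r * ap - r * am + 2 * I * r * z)) ≠ 0) :
    G r ap am z =
      doubleQPochhammer (exp (-2 * ap * r)) (exp (-2 * am * r))
        (exp (-r * ap - r * am + -(2 * I * r * z))) /
      doubleQPochhammer (exp (-2 * ap * r)) (exp (-2 * am * r))
        (exp (-r * ap - r * am + 2 * I * r * z)) := by
  have hp := norm_exp_lt_one hr hap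
  have hq := norm_exp_lt_one hr ham
  rw [doubleQPochhammer, doubleQPochhammer,
    ← Multipliable.tprod_div₀ (multipliable_doubleQPochhammer hp hq _)
      (multipliable_doubleQPochhammer hp hq _) h, G]
  refine tprod_congr fun k => ?_
  rw [← exp_eq_mul_pow_mul_pow, ← exp_eq_mul_pow_mul_pow, ← sub_eq_add_neg]

theorem G_add (hr : 0 < r) (hap : 0 < ap) (ham : 0 < am) {u : ℂ} (h : GRegular r ap am u) :
    G r ap am (u + I * am) = R r ap (u + I * am / 2) * G r ap am u := by
  have hp := norm_exp_lt_one hr hap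
  have hq := norm_exp_lt_one hr ham
  have hden := doubleQPochhammer_ne_zero_of_gRegular hr hap ham h
  set x := exp (-r * ap - r * am + 2 * I * r * u) with hx
  set y := exp (-r * ap - r * am + -(2 * I * r * (u + I * am))) with hy
  have hxq : exp (-r * ap - r * am + 2 * I * r * (u + I * am)) = x * exp (-2 * am * r) := by
    rw [hx, ← exp_add]; congr 1; linear_combination (2 * r * am : ℂ) * I_sq
  have hyq : exp (-r * ap - r * am + -(2 * I * r * u)) = y * exp (-2 * am * r) := by
    rw [hy, ← exp_add]; congr 1; linear_combination (2 * r * am : ℂ) * I_sq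
  have hxR : exp (2 * I * r * (u + I * am / 2) - ap * r) = x := by
    rw [hx]; congr 1; linear_combination (r * am : ℂ) * I_sq
  have hyR : exp (-2 * I * r * (u + I * am / 2) - ap * r) = y := by
    rw [hy]; congr 1; linear_combination (r * am : ℂ) * I_sq
  obtain ⟨hx₁, hx₂⟩ := mul_ne_zero_iff.mp (doubleQPochhammer_eq_mul hp hq x ▸ hden)
  rw [G_eq_div hr hap ham hden, G_eq_div hr hap ham (by rwa [hxq]), hxq, hyq,
    R_eq_qPochhammer hr hap, hxR, hyR, ← hx, ← hy, doubleQPochhammer_eq_mul hp hq x,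
    doubleQPochhammer_eq_mul hp hq y]
  generalize exp (-2 * ap * r) = p, exp (-2 * am * r) = q at *
  field_simp

theorem G_swap (r ap am : ℝ) (z : ℂ) : G r ap am z = G r am ap z := by
  rw [G, G, ← (Equiv.prodComm ℕ ℕ).tprod_eq]
  refine tprod_congr fun k => ?_
  simp only [Equiv.prodComm_apply, Prod.fst_swap, Prod.snd_swap]
  congr 3 <;> ring

theorem GRegular.swap {z : ℂ} (h : GRegular r ap am z) : GRegular r am ap z := fun m n => by
  convert h n m using 3
  ring

theorem aSign_pos (hap : 0 < ap) (ham : 0 < am) (δ : Bool) : 0 < aSign ap am δ := by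
  cases δ <;> simpa [aSign]

theorem aSign_add_aSign_not (ap am : ℝ) (δ : Bool) :
    aSign ap am δ + aSign ap am (!δ) = ap + am := by
  cases δ <;> simp [aSign, add_comm]

theorem G_add_aSign (hr : 0 < r) (hap : 0 < ap) (ham : 0 < am) (δ : Bool) {u : ℂ}
    (h : GRegular r ap am u) :
    G r ap am (u + I * aSign ap am (!δ)) =
      RSign r ap am δ (u + I * aSign ap am (!δ) / 2) * G r ap am u := by
  cases δ
  · rw [G_swap, G_swap r ap am u]
    exact G_add hr ham hap h.swap
  · exact G_add hr hap ham h

end EllipticGamma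

section KernelFunction

variable {r ap am : ℝ}

theorem kernelArg_shift (b : ℝ) (v w z : Fin 3 → ℂ) (j k l m : Fin 3) :
    kernelArg ap am (shift b j v) w z k l m =
      kernelArg ap am v w z k l m - I * b / 3 + if k = j then I * b else 0 := by
  simp only [kernelArg, shift]
  split_ifs <;> ring

/-- The part of the kernel function that a shift of `v` in direction `j` changes in the same way
for all `j`; it is symmetric in `v` and `w`. -/
def commonFactor (r ap am b : ℝ) (v w z : Fin 3 → ℂ) : ℂ :=
  ∏ k, ∏ l, ∏ m, G r ap am (kernelArg ap am v w z k l m - I * b / 3)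

theorem commonFactor_comm (b : ℝ) (v w z : Fin 3 → ℂ) :
    commonFactor r ap am b v w z = commonFactor r ap am b w v z := by
  rw [commonFactor, Finset.prod_comm]
  simp only [commonFactor, kernelArg, add_comm]

theorem G_kernelArg_shift (hr : 0 < r) (hap : 0 < ap) (ham : 0 < am) (δ : Bool)
    {v w z : Fin 3 → ℂ} {k l m : Fin 3}
    (h : GRegular r ap am (kernelArg ap am v w z k l m - I * aSign ap am (!δ) / 3)) (j : Fin 3) :
    G r ap am (kernelArg ap am (shift (aSign ap am (!δ)) j v) w z k l m) =
      (if k = j then RSign r ap am δ (v j + w l + z m - I * aSign ap am δ / 6) else 1) *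
        G r ap am (kernelArg ap am v w z k l m - I * aSign ap am (!δ) / 3) := by
  rw [kernelArg_shift]
  split_ifs with hk
  · have hδ : (aSign ap am δ + aSign ap am (!δ) : ℂ) = ap + am := by
      exact_mod_cast aSign_add_aSign_not ap am δ
    rw [G_add_aSign hr hap ham δ h, kernelArg, hk]
    congr 2
    linear_combination (I / 6) * hδ
  · rw [add_zero, one_mul]

theorem S2_shift (hr : 0 < r) (hap : 0 < ap) (ham : 0 < am) (δ : Bool) {v w z : Fin 3 → ℂ}
    (h : ∀ k l m, GRegular r ap am (kernelArg ap am v w z k l m - I * aSign ap am (!δ) / 3))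
    (j : Fin 3) :
    S2 r ap am (shift (aSign ap am (!δ)) j v) w z =
      (∏ l, ∏ m, RSign r ap am δ (v j + w l + z m - I * aSign ap am δ / 6)) *
        commonFactor r ap am (aSign ap am (!δ)) v w z := by
  simp only [S2, fun k l m => G_kernelArg_shift hr hap ham δ (h k l m) j, Finset.prod_mul_distrib,
    commonFactor]
  congr 1
  rw [Fintype.prod_eq_single j fun k hk => by simp [hk]]
  simp

theorem gRegular_of_a2Regular {δ : Bool} {v w z : Fin 3 → ℂ}
    (h : A2Regular r ap am δ (fun x => S2Regular r ap am x w z) v) (k l m : Fin 3) :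
    GRegular r ap am (kernelArg ap am v w z k l m - I * aSign ap am (!δ) / 3) := by
  have hk : k ≠ k + 1 := by revert k; decide
  have := h.2 (k + 1) k l m
  rwa [kernelArg_shift, if_neg hk, add_zero] at this

theorem A2_S2_eq (hr : 0 < r) (hap : 0 < ap) (ham : 0 < am) (δ : Bool) (μ : ℂ)
    {v w z : Fin 3 → ℂ} (h : A2Regular r ap am δ (fun x => S2Regular r ap am x w z) v) :
    A2 r ap am δ μ (fun x => S2 r ap am x w z) v =
      (∑ j, coeff r ap am δ μ j v *
        ∏ l, ∏ m, RSign r ap am δ (v j + w l + z m - I * aSign ap am δ / 6)) *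
          commonFactor r ap am (aSign ap am (!δ)) v w z := by
  rw [A2, Finset.sum_mul]
  refine Finset.sum_congr rfl fun j _ => ?_
  rw [S2_shift hr hap ham δ (gRegular_of_a2Regular h), mul_assoc]

end KernelFunction

section Reduction

theorem sum_shift (b : ℝ) (j : Fin 3) (x : Fin 3 → ℂ) : ∑ k, shift b j x k = ∑ k, x k := by
  have hdir : ∑ k, (if k = j then 2 else -1 : ℂ) = 0 := by
    have : ∑ k, (if k = j then 2 else -1 : ℤ) = 0 := by revert j; decide
    exact_mod_cast this
  simp only [shift, Finset.sum_add_distrib, ← Finset.mul_sum, hdir, mul_zero, add_zero]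

variable {r α : ℝ}

theorem R_add_mul_R_sub (hr : 0 < r) (hα : 0 < α) (x μ : ℂ) :
    R r α (x + μ) * R r α (x - μ) =
      -exp (2 * I * r * (μ + I * α / 2)) * bracket (sigma r α) x (μ + I * α / 2) := by
  have hexp : exp (2 * I * r * (μ + I * α / 2)) =
      exp (I * r * (x + (μ + I * α / 2))) * exp (-I * r * (x - (μ + I * α / 2))) := by
    rw [← exp_add]
    ring_nf
  have hadd : x + μ = x + (μ + I * α / 2) - I * α / 2 := by ring
  have hsub : x - μ = x - (μ + I * α / 2) + I * α / 2 := by ring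
  rw [hadd, hsub, R_sub_half, R_add_half_eq_sigma hr hα, hexp, bracket]
  ring

theorem prod_R_add (hr : 0 < r) (hα : 0 < α) {z : Fin 3 → ℂ} (hz : ∑ m, z m = 0) (x : ℂ) :
    ∏ m, R r α (x + z m - I * α / 6) =
      -exp (I * r * (x - 2 * shift (-α) 0 z 0)) * ∏ m, sigma r α (x + shift (-α) 0 z m) := by
  have hz' := (sum_shift (-α) 0 z).trans hz
  have h0 : x + z 0 - I * α / 6 = x + shift (-α) 0 z 0 + I * α / 2 := by
    simp only [shift, Fin.isValue, ↓reduceIte, ofReal_neg]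
    ring
  have h1 : x + z 1 - I * α / 6 = x + shift (-α) 0 z 1 - I * α / 2 := by
    simp only [shift, Fin.isValue, Fin.reduceEq, ↓reduceIte, ofReal_neg]
    ring
  have h2 : x + z 2 - I * α / 6 = x + shift (-α) 0 z 2 - I * α / 2 := by
    simp only [shift, Fin.isValue, Fin.reduceEq, ↓reduceIte, ofReal_neg]
    ring
  rw [Fin.prod_univ_three, Fin.prod_univ_three, h0, h1, h2, R_add_half_eq_sigma hr hα, R_sub_half,
    R_sub_half]
  generalize shift (-α) 0 z = y at hz' ⊢
  rw [Fin.sum_univ_three] at hz'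
  have hexp : exp (I * r * (x - 2 * y 0)) =
      exp (-I * r * (x + y 0)) * exp (I * r * (x + y 1)) * exp (I * r * (x + y 2)) := by
    rw [← exp_add, ← exp_add]
    congr 1
    linear_combination (-I * r) * hz'
  rw [hexp]
  ring

theorem prod_prod_R_add (hr : 0 < r) (hα : 0 < α) {w z : Fin 3 → ℂ} (hw : ∑ l, w l = 0)
    (hz : ∑ m, z m = 0) (x : ℂ) :
    ∏ l, ∏ m, R r α (x + w l + z m - I * α / 6) =
      -(exp (3 * I * r * x) * exp (-(6 * I * r * shift (-α) 0 z 0))) *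
        ∏ l, ∏ m, sigma r α (x + w l + shift (-α) 0 z m) := by
  simp only [prod_R_add hr hα hz]
  generalize shift (-α) 0 z = y
  have hexp : exp (3 * I * r * x) * exp (-(6 * I * r * y 0)) =
      ∏ l, exp (I * r * (x + w l - 2 * y 0)) := by
    rw [Fin.sum_univ_three] at hw
    rw [Fin.prod_univ_three, ← exp_add, ← exp_add, ← exp_add]
    congr 1
    linear_combination (-I * r) * hw
  rw [hexp, Finset.prod_mul_distrib, Finset.prod_neg]
  norm_num

theorem R_sub_mul_R_sub (r α : ℝ) {a b c : ℂ} (h : a + b + c = 0) :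
    R r α (a - b - I * α / 2) * R r α (a - c - I * α / 2) =
      exp (3 * I * r * a) * (sigma r α (a - b) * sigma r α (a - c)) := by
  have hexp : exp (3 * I * r * a) = exp (I * r * (a - b)) * exp (I * r * (a - c)) := by
    rw [← exp_add]
    congr 1
    linear_combination (I * r) * h
  rw [R_sub_half, R_sub_half, hexp]
  ring

theorem coeff_mul_prod_prod_eq {r ap am : ℝ} (hr : 0 < r) (hap : 0 < ap) (ham : 0 < am) (δ : Bool)
    (μ : ℂ) {v w z : Fin 3 → ℂ} (hv : ∑ j, v j = 0) (hw : ∑ l, w l = 0) (hz : ∑ m, z m = 0)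
    (j : Fin 3) :
    coeff r ap am δ μ j v * ∏ l, ∏ m, RSign r ap am δ (v j + w l + z m - I * aSign ap am δ / 6) =
      exp (2 * I * r * (μ + I * aSign ap am δ / 2)) *
        exp (-(6 * I * r * shift (-aSign ap am δ) 0 z 0)) *
        kernelTerm (sigma r (aSign ap am δ)) (μ + I * aSign ap am δ / 2)
          (v j) (v (j + 1)) (v (j + 2)) w (shift (-aSign ap am δ) 0 z) := by
  have hα := aSign_pos hap ham δ
  have hsum : v j + v (j + 1) + v (j + 2) = 0 := by
    rw [← hv, ← Equiv.sum_comp (Equiv.addLeft j), Fin.sum_univ_three]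
    simp only [Equiv.coe_addLeft, add_zero]
  simp only [coeff, RSign]
  rw [R_add_mul_R_sub hr hα, R_sub_mul_R_sub _ _ hsum, prod_prod_R_add hr hα hw hz, kernelTerm]
  generalize sigma r (aSign ap am δ) = s
  have := exp_ne_zero (3 * I * r * v j)
  field_simp

theorem sum_coeff_mul_prod_prod_eq {r ap am : ℝ} (hr : 0 < r) (hap : 0 < ap) (ham : 0 < am)
    (δ : Bool) (μ : ℂ) {v w z : Fin 3 → ℂ} (hv : ∑ j, v j = 0) (hw : ∑ l, w l = 0)
    (hz : ∑ m, z m = 0) :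
    ∑ j, coeff r ap am δ μ j v *
        ∏ l, ∏ m, RSign r ap am δ (v j + w l + z m - I * aSign ap am δ / 6) =
      exp (2 * I * r * (μ + I * aSign ap am δ / 2)) *
        exp (-(6 * I * r * shift (-aSign ap am δ) 0 z 0)) *
        kernelSum (sigma r (aSign ap am δ)) (μ + I * aSign ap am δ / 2) v w
          (shift (-aSign ap am δ) 0 z) := by
  rw [kernelSum, Finset.mul_sum]
  exact Finset.sum_congr rfl fun j _ => coeff_mul_prod_prod_eq hr hap ham δ μ hv hw hz j

variable {ap am : ℝ}

theorem sigma_sub_ne_zero {δ : Bool} {reg : (Fin 3 → ℂ) → Prop} {v : Fin 3 → ℂ}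
    (h : A2Regular r ap am δ reg v) (j k : Fin 3) (hjk : j ≠ k) :
    sigma r (aSign ap am δ) (v j - v k) ≠ 0 :=
  mul_ne_zero (exp_ne_zero _) (h.1 j k hjk)

theorem kernelArg_rotate (ap am : ℝ) (v w z : Fin 3 → ℂ) (k l m : Fin 3) :
    kernelArg ap am v w z k l m = kernelArg ap am w z v l m k := by
  simp only [kernelArg]
  ring

theorem S2_rotate (r ap am : ℝ) (v w z : Fin 3 → ℂ) :
    S2 r ap am v w z = S2 r ap am w z v := by
  simp only [S2, kernelArg_rotate ap am v w z]
  rw [Finset.prod_comm]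
  exact Finset.prod_congr rfl fun l _ => Finset.prod_comm

theorem S2Regular_rotate (r ap am : ℝ) (v w z : Fin 3 → ℂ) :
    S2Regular r ap am v w z ↔ S2Regular r ap am w z v := by
  simp only [S2Regular, kernelArg_rotate ap am v w z]
  exact ⟨fun h l m k => h k l m, fun h k l m => h l m k⟩

theorem S2_swap (r ap am : ℝ) (v w z : Fin 3 → ℂ) : S2 r ap am v w z = S2 r ap am w v z := by
  rw [S2, Finset.prod_comm]
  simp only [S2, kernelArg, add_comm]

theorem S2Regular.swap {v w z : Fin 3 → ℂ} (h : S2Regular r ap am v w z) :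
    S2Regular r ap am w v z := fun k l m => by
  simpa only [kernelArg, add_comm] using h l k m

theorem A2Regular.mono {δ : Bool} {reg reg' : (Fin 3 → ℂ) → Prop} {v : Fin 3 → ℂ}
    (h : A2Regular r ap am δ reg v) (hreg : ∀ x, reg x → reg' x) : A2Regular r ap am δ reg' v :=
  ⟨h.1, fun j => hreg _ (h.2 j)⟩

theorem A2_S2_comm (hr : 0 < r) (hap : 0 < ap) (ham : 0 < am) (δ : Bool) (μ : ℂ)
    {v w z : Fin 3 → ℂ} (hv : ∑ j, v j = 0) (hw : ∑ j, w j = 0) (hz : ∑ j, z j = 0)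
    (h : A2Regular r ap am δ (fun x => S2Regular r ap am x w z) v)
    (h' : A2Regular r ap am δ (fun x => S2Regular r ap am v x z) w) :
    A2 r ap am δ μ (fun x => S2 r ap am x w z) v =
      A2 r ap am δ μ (fun x => S2 r ap am v x z) w := by
  have hα := aSign_pos hap ham δ
  simp only [S2_swap r ap am v]
  rw [A2_S2_eq hr hap ham δ μ h, A2_S2_eq hr hap ham δ μ (h'.mono fun _ => S2Regular.swap),
    commonFactor_comm _ w v z, sum_coeff_mul_prod_prod_eq hr hap ham δ μ hv hw hz,
    sum_coeff_mul_prod_prod_eq hr hap ham δ μ hw hv hz,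
    kernelSum_comm (sigmaLike_sigma hr hα) (differentiable_sigma hr hα) _ hv hw
      ((sum_shift _ _ _).trans hz) (sigma_sub_ne_zero h) (sigma_sub_ne_zero h')]

end Reduction

end Razamat

end

theorem corollary2p3 (r ap am : ℝ) (hr : 0 < r) (hap : 0 < ap) (ham : 0 < am)
    (δ : Bool) (μ : ℂ) (v w z : Fin 3 → ℂ)
    (hv : ∑ j, v j = 0) (hw : ∑ j, w j = 0) (hz : ∑ j, z j = 0) :
    (Razamat.A2Regular r ap am δ (fun x => Razamat.S2Regular r ap am x w z) v →
      Razamat.A2Regular r ap am δ (fun x => Razamat.S2Regular r ap am v x z) w →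
      Razamat.A2 r ap am δ μ (fun x => Razamat.S2 r ap am x w z) v =
        Razamat.A2 r ap am δ μ (fun x => Razamat.S2 r ap am v x z) w) ∧
    (Razamat.A2Regular r ap am δ (fun x => Razamat.S2Regular r ap am v x z) w →
      Razamat.A2Regular r ap am δ (fun x => Razamat.S2Regular r ap am v w x) z →
      Razamat.A2 r ap am δ μ (fun x => Razamat.S2 r ap am v x z) w =
        Razamat.A2 r ap am δ μ (fun x => Razamat.S2 r ap am v w x) z) ∧
    (Razamat.A2Regular r ap am δ (fun x => Razamat.S2Regular r ap am x w z) v →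
      Razamat.A2Regular r ap am δ (fun x => Razamat.S2Regular r ap am v w x) z →
      Razamat.A2 r ap am δ μ (fun x => Razamat.S2 r ap am x w z) v =
        Razamat.A2 r ap am δ μ (fun x => Razamat.S2 r ap am v w x) z) := by
  refine ⟨Razamat.A2_S2_comm hr hap ham δ μ hv hw hz, ?_, fun h h' => ?_⟩
  · simp only [Razamat.S2_rotate r ap am v, Razamat.S2Regular_rotate r ap am v]
    exact Razamat.A2_S2_comm hr hap ham δ μ hw hz hv
  · simp only [← fun x => Razamat.S2_rotate r ap am z x w,
      ← fun x => Razamat.S2Regular_rotate r ap am z x w,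
      ← fun x => Razamat.S2_rotate r ap am x v w,
      ← fun x => Razamat.S2Regular_rotate r ap am x v w] at h h' ⊢
    exact (Razamat.A2_S2_comm hr hap ham δ μ hz hv hw h' h).symm
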